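/- Let $\mathcal H$ be a real Hilbert space and $M$ a bounded, linear, self-adjoint, strongly positive operator on $\mathcal H$; write $\|x\|_M=\sqrt{\langle x,Mx\rangle}$. **Setting.** Let $A:\mathcal H\to 2^{\mathcal H}$ be maximally monotone, $\beta\ge 0$, and let $C:\mathcal H\to\mathcal H$ be $\frac1\beta$-cocoercive with respect to $\|\cdot\|_M$, i.e. $\beta\langle Cx-Cy,x-y\rangle\ge\|Cx-Cy\|_{M^{-1}}^2$ for all $x,y$. Assume $\operatorname{zer}(A+C)=\{x: 0\in Ax+Cx\}\neq\emptyset$. Let $e\in[0,1]$, $\gamma>0$, $\bar\beta\ge\beta$, $\varepsilon>0$, and $$\lambda_n=\left(1-\tfrac{\gamma\bar\beta}{4}\right)^e(1+n)^e\quad(n\in\mathbb N),$$ and suppose $\lambda_0>0$ and $\varepsilon\le\gamma\bar\beta\le 4-2\lambda_0-\varepsilon$. From $y_0\in\mathcal H$ and $y_{-1}=p_{-1}=y_0$, let, for all $n\in\mathbb N$, $$p_n=(M+\gamma A)^{-1}(My_n-\gamma Cy_n),$$ $$y_{n+1}=y_n+\left(\tfrac{\lambda_0\lambda_n}{\lambda_{n+1}}+\tfrac{\lambda_{n+1}-\lambda_0}{\lambda_{n+1}}\tfrac{4-\gamma\bar\beta-2\lambda_0}{2}\right)(p_n-y_n)+\tfrac{\lambda_n-\lambda_0}{\lambda_{n+1}}\left((y_n-y_{n-1})+\tfrac{4-\gamma\bar\beta}{2}(y_{n-1}-p_{n-1})\right).$$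 Then: 1. If $e>0$, then for every $x^\star\in\operatorname{zer}(A+C)$ and $n\in\mathbb N$, $$\left\|\tfrac1\gamma(p_n-y_n)\right\|_M^2\le\frac{2\|y_0-x^\star\|_M^2}{\gamma^2(4-\gamma\bar\beta-2\lambda_0)\lambda_0(1+n)^{2e}}.$$ 2. If $\bar\beta>\beta$ and $e<1$, then $(\|p_n-y_n\|^2)_{n\in\mathbb N}$ is summable. 3. If $e=0$, the method is forward--backward splitting, $y_{n+1}=p_n=(M+\gamma A)^{-1}(My_n-\gamma Cy_n)$, and $(p_n)$ converges weakly to some $x^\star\in\operatorname{zer}(A+C)$. 4. If $e=1$, then for all $n\in\mathbb N$ $$y_{n+1}=\tfrac{\gamma\bar\beta(1+n)}{4+2n}y_n+\tfrac{n(2-\gamma\bar\beta)}{4+2n}y_{n-1}+\tfrac{(1+n)(4-\gamma\bar\beta)}{4+2n}p_n-\tfrac{n(4-\gamma\bar\beta)}{4+2n}p_{n-1},$$ and for every $x^\star\in\operatorname{zer}(A+C)$ $$\left\|\tfrac1\gamma(p_n-y_n)\right\|_M^2\le\frac{16\|y_0-x^\star\|_M^2}{\gamma^2(4-\gamma\bar\beta)^2(1+n)^2}.$$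 5. (Halpern iteration.) If $e=1$, $A=0$, $\bar\beta=\beta$ and $\gamma\beta=2$, then $N:=\mathrm{Id}-\frac2\beta M^{-1}C$ is nonexpansive in $\|\cdot\|_M$, and for all $n\in\mathbb N$: $p_n=Ny_n$, $y_{n+1}=\frac1{n+2}y_0+\frac{n+1}{n+2}Ny_n$, and $\|p_n-y_n\|_M^2\le\frac{4\|y_0-x^\star\|_M^2}{(1+n)^2}$ for every $x^\star\in\operatorname{zer}(A+C)$. Moreover, for every $N:\mathcal H\to\mathcal H$ that is nonexpansive in $\|\cdot\|_M$, every sequence with $y_{n+1}=\frac1{n+2}y_0+\frac{n+1}{n+2}Ny_n$ and every fixed point $x^\star$ of $N$, $$\|Ny_n-y_n\|_M^2\le\frac{4\|y_0-x^\star\|_M^2}{(1+n)^2}\qquad(n\in\mathbb N).$$ 6. (Accelerated proximal point method.) For every maximally monotone $A$ and every $\gamma>0$, the recursion above with $C=0$, $\bar\beta=0$, $e=1$ (hence $\lambda_n=1+n$) is equivalent to the accelerated proximal point method $$p_n=(M+\gamma A)^{-1}My_n,\qquad y_{n+1}=p_n+\tfrac{n}{n+2}(p_n-p_{n-1})-\tfrac{n}{n+2}(p_{n-1}-y_{n-1}),$$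 with $y_{-1}=p_{-1}=y_0$, and for every $x^\star$ with $0\in Ax^\star$ and $n\in\mathbb N$, $$\left\|\tfrac1\gamma(p_n-y_n)\right\|_M^2\le\frac{\|y_0-x^\star\|_M^2}{\gamma^2(1+n)^2}.$$ -/

import Mathlib

open Filter Topology
open scoped InnerProductSpace

noncomputable section

namespace TunableFB

variable {H : Type*} [NormedAddCommGroup H] [InnerProductSpace ℝ H]

/-- `M` is a (bounded, linear) self-adjoint and strongly positive operator. -/
def IsStronglyPositive [CompleteSpace H] (M : H →L[ℝ] H) : Prop :=
  IsSelfAdjoint M ∧ ∃ c : ℝ, 0 < c ∧ ∀ x : H, c * ‖x‖ ^ 2 ≤ ⟪x, M x⟫_ℝ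

/-- The norm `‖x‖_M = √⟨x, M x⟩`. -/
def normM (M : H →L[ℝ] H) (x : H) : ℝ := √⟪x, M x⟫_ℝ

/-- Monotonicity of a set-valued operator `A : H → 2^H`. -/
def IsMonotoneOp (A : H → Set H) : Prop :=
  ∀ x u y v, u ∈ A x → v ∈ A y → 0 ≤ ⟪u - v, x - y⟫_ℝ

/-- Maximal monotonicity: no monotone operator has a graph properly containing that of `A`. -/
def IsMaximallyMonotone (A : H → Set H) : Prop :=
  IsMonotoneOp A ∧ ∀ B : H → Set H, IsMonotoneOp B → (∀ x, A x ⊆ B x) → B = A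

/-- `C` is `1/β`-cocoercive with respect to `‖·‖_M`:
`β ⟨C x - C y, x - y⟩ ≥ ‖C x - C y‖²` in the norm of `M⁻¹`.
(For strongly positive `M`, `M.inverse` is the inverse operator.) -/
def IsCocoercive (M : H →L[ℝ] H) (β : ℝ) (C : H → H) : Prop :=
  ∀ x y, normM M.inverse (C x - C y) ^ 2 ≤ β * ⟪C x - C y, x - y⟫_ℝ

/-- `N` is nonexpansive in the norm `‖·‖_M`. -/
def IsNonexpansiveM (M : H →L[ℝ] H) (N : H → H) : Prop :=
  ∀ x y, normM M (N x - N y) ≤ normM M (x - y)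

/-- `zer (A + C) = {x | 0 ∈ A x + C x}`. -/
def zer (A : H → Set H) (C : H → H) : Set H :=
  {x | ∃ a ∈ A x, a + C x = 0}

/-- The resolvent set `(M + γ A)⁻¹ z`, the set of all `p` with `z ∈ M p + γ A p`. -/
def resolvent (M : H →L[ℝ] H) (A : H → Set H) (γ : ℝ) (z : H) : Set H :=
  {p | ∃ a ∈ A p, M p + γ • a = z}

/-- The forward-backward step `(M + γ A)⁻¹ (M y - γ C y)`. For monotone `A`, strongly positive `M`
and `γ > 0` it contains at most one point. -/
def fbStep (M : H →L[ℝ] H) (A : H → Set H) (C : H → H) (γ : ℝ) (y : H) : Set H :=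
  resolvent M A γ (M y - γ • C y)

/-- The interpolating forward-backward algorithm with step size `γ`, parameter `βb` and relaxation
sequence `lam`, initialised with `y₋₁ = p₋₁ = y₀`. The sequences are indexed by `ℤ` so that the
index `-1` is available; only indices `≥ -1` are constrained. -/
structure IsInterpolatingFB (M : H →L[ℝ] H) (A : H → Set H) (C : H → H) (γ βb : ℝ)
    (lam : ℕ → ℝ) (y p : ℤ → H) : Prop where
  init_y : y (-1) = y 0
  init_p : p (-1) = y 0
  step_p : ∀ n : ℕ, p n ∈ fbStep M A C γ (y n)
  step_y : ∀ n : ℕ, y (n + 1) = y n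
    + (lam 0 * lam n / lam (n + 1)
        + (lam (n + 1) - lam 0) / lam (n + 1) * ((4 - γ * βb - 2 * lam 0) / 2)) • (p n - y n)
    + ((lam n - lam 0) / lam (n + 1)) •
        ((y n - y (n - 1)) + ((4 - γ * βb) / 2) • (y (n - 1) - p (n - 1)))

/-- The relaxation sequence `λ_n = (1 - γ βb / 4)^e (1 + n)^e`. -/
def tunableLam (γ βb e : ℝ) (n : ℕ) : ℝ := (1 - γ * βb / 4) ^ e * (1 + (n : ℝ)) ^ e

/-- The accelerated proximal point method (in the metric of `M`). -/
structure IsAcceleratedPPM (M : H →L[ℝ] H) (A : H → Set H) (γ : ℝ) (y p : ℤ → H) : Prop where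
  init_y : y (-1) = y 0
  init_p : p (-1) = y 0
  step_p : ∀ n : ℕ, p n ∈ resolvent M A γ (M (y n))
  step_y : ∀ n : ℕ, y (n + 1) = p n
    + ((n : ℝ) / (n + 2)) • (p n - p (n - 1))
    - ((n : ℝ) / (n + 2)) • (p (n - 1) - y (n - 1))

/-- The Halpern iteration `y_{n+1} = y_0 / (n+2) + (n+1)/(n+2) N y_n`. -/
def IsHalpern (N : H → H) (y : ℕ → H) : Prop :=
  ∀ n : ℕ, y (n + 1) = (1 / ((n : ℝ) + 2)) • y 0 + (((n : ℝ) + 1) / (n + 2)) • N (y n)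

/-- Weak convergence of a sequence in `H`. -/
def WeaklyConverges (x : ℕ → H) (l : H) : Prop :=
  Tendsto (fun n => toWeakSpace ℝ H (x n)) atTop (𝓝 (toWeakSpace ℝ H l))

end TunableFB

end

/-!
Write `r n = y n - p n` for the residual, `κ = 1 - γ βb / 4`, `a = λ 0`, and let `B` be the bilinear
form `⟨x, M y⟩`. Monotonicity of `A` and cocoercivity of `C` enter only through one inequality:
the residual map of the forward-backward step is `κ`-cocoercive for `B`
(`fbStep_cocoercive`, obtained by completing a square). After that everything is algebra with `B`.

With the momentum `w n = y n - y (n-1) + 2κ (y (n-1) - p (n-1))` the recursion becomes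
`y (n+1) = y n + w (n+1) - 2κ r n`,
`λ (n+1) w (n+1) = (λ n - a) w n + a (λ (n+1) - λ n + 2κ - a) r n`
(`IsRelaxedIteration`). The point `x n = y n + (λ n / a - 1) w n` then moves by
`-(a + λ n - λ (n+1)) r n` (`IsRelaxedIteration.anchor_succ`); it is fixed for `e = 1`, which is the
anchoring of Halpern's iteration. The Lyapunov function is
`V n = B (x n - x⋆, x n - x⋆) - 2 (λ n / a - 1) λ n (B (r n, w n) - κ B (r n, r n))`.
Cocoercivity between consecutive iterates controls the second term, cocoercivity against a zero
`x⋆` the first, and together they make `V` decrease by a multiple of `B (r n, r n)`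
(`IsRelaxedIteration.lyapunov_succ_le`). Completing the square in `x n - x⋆ - λ n r n` shows
`(2κ - a) / a * λ n ^ 2 * B (r n, r n) ≤ V n` (`residual_le_lyapunov`). As `V 0` is the squared
distance of `y 0` to `x⋆`, all the rates follow, and for `e < 1` the decrease is bounded
below by a positive multiple of `B (r n, r n)`, which gives summability. Halpern's iteration for an
arbitrary nonexpansive `N` satisfies the same recursion with `κ = a = 1 / 2`.

For `e = 0` the function `V n` is the squared distance of `y n` to `x⋆`, so the iterates are Fejér
monotone; weak convergence follows from Opial's argument (`opial`), run along ultrafilters, together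
with the fact that weak limits of points with vanishing residuals are zeros
(`mem_zer_of_weak_limit`). The latter uses maximality of `A` directly, so that no surjectivity
theorem for resolvents is needed.
-/

namespace TunableFB

/-! ### A Lyapunov function for the relaxed recursion -/

section Bilinear

variable {E : Type*} [AddCommGroup E] [Module ℝ E]

/-- The two-term form of the recursion: iterates `y`, residuals `r` and momentum `w`. The residuals
are arbitrary vectors here; how they arise from `y` enters later through cocoercivity. -/
structure IsRelaxedIteration (κ a : ℝ) (lam : ℕ → ℝ) (y r w : ℕ → E) : Prop where
  init_w : w 0 = 0
  step_y : ∀ n, y (n + 1) = y n + w (n + 1) - (2 * κ) • r n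
  step_w : ∀ n, lam (n + 1) • w (n + 1) =
    (lam n - a) • w n + (a * (lam (n + 1) - lam n + 2 * κ - a)) • r n

/-- The auxiliary point `x n = y n + (λ n / a - 1) w n`, which equals `y n` when `λ` is constant and
`y 0` when `λ n = a (n + 1)`. -/
noncomputable def anchor (a : ℝ) (lam : ℕ → ℝ) (y w : ℕ → E) (n : ℕ) : E :=
  y n + (lam n / a - 1) • w n

/-- The Lyapunov function of a relaxed iteration, relative to the point `xs`. -/
noncomputable def lyapunov (B : LinearMap.BilinForm ℝ E) (κ a : ℝ) (lam : ℕ → ℝ) (y r w : ℕ → E)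
    (xs : E) (n : ℕ) : ℝ :=
  B (anchor a lam y w n - xs) (anchor a lam y w n - xs)
    - 2 * (lam n / a - 1) * (lam n * (B (r n) (w n) - κ * B (r n) (r n)))

variable {κ a : ℝ} {lam : ℕ → ℝ} {y r w : ℕ → E}

theorem IsRelaxedIteration.anchor_succ (h : IsRelaxedIteration κ a lam y r w) (ha : a ≠ 0)
    (n : ℕ) :
    anchor a lam y w (n + 1) = anchor a lam y w n - (a + lam n - lam (n + 1)) • r n := by
  have key : (lam (n + 1) / a) • w (n + 1) =
      (lam n / a - 1) • w n + (lam (n + 1) - lam n + 2 * κ - a) • r n := by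
    have := congrArg (fun v => a⁻¹ • v) (h.step_w n)
    simp only [smul_add, smul_smul] at this
    rw [show lam (n + 1) / a = a⁻¹ * lam (n + 1) by ring, this]
    match_scalars <;> field_simp
  rw [anchor, anchor, sub_smul, key, h.step_y n]
  module

variable {B : LinearMap.BilinForm ℝ E}

/-- Lower bound for the growth of the cross term `B (r, w) - κ B (r, r)`, from cocoercivity between
two consecutive iterates. -/
theorem IsRelaxedIteration.le_cross_succ (h : IsRelaxedIteration κ a lam y r w)
    (hB : B.IsSymm) (n : ℕ) (hlam : 0 ≤ lam (n + 1))
    (hstep : κ * B (r (n + 1) - r n) (r (n + 1) - r n) ≤ B (r (n + 1) - r n) (y (n + 1) - y n)) :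
    (lam n - a) * (B (r n) (w n) - κ * B (r n) (r n))
        - (a - κ) * (a + lam n - lam (n + 1)) * B (r n) (r n) ≤
      lam (n + 1) * (B (r (n + 1)) (w (n + 1)) - κ * B (r (n + 1)) (r (n + 1))) := by
  have hw : lam (n + 1) * B (r n) (w (n + 1)) = (lam n - a) * B (r n) (w n)
      + a * (lam (n + 1) - lam n + 2 * κ - a) * B (r n) (r n) := by
    simpa using congrArg (B (r n)) (h.step_w n)
  have hs : B (r (n + 1)) (r n) = B (r n) (r (n + 1)) := hB.eq _ _
  have hy : y (n + 1) - y n = w (n + 1) - (2 * κ) • r n := by rw [h.step_y n]; abel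
  rw [hy] at hstep
  simp only [map_sub, map_smul, LinearMap.sub_apply, smul_eq_mul] at hstep
  have := mul_le_mul_of_nonneg_left hstep hlam
  linear_combination this - hw - κ * lam (n + 1) * hs

/-- The Lyapunov function decreases by a multiple of the squared residual. -/
theorem IsRelaxedIteration.lyapunov_succ_le (h : IsRelaxedIteration κ a lam y r w)
    (hB : B.IsSymm) (ha : 0 < a) (n : ℕ) (hlam : a ≤ lam (n + 1))
    (hα : 0 ≤ a + lam n - lam (n + 1)) {xs : E}
    (hstep : κ * B (r (n + 1) - r n) (r (n + 1) - r n) ≤ B (r (n + 1) - r n) (y (n + 1) - y n))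
    (hxs : κ * B (r n) (r n) ≤ B (r n) (y n - xs)) :
    lyapunov B κ a lam y r w xs (n + 1) + (a + lam n - lam (n + 1)) * ((2 * κ - a) / a) *
        (2 * lam n - (a + lam n - lam (n + 1))) * B (r n) (r n) ≤
      lyapunov B κ a lam y r w xs n := by
  have hE := h.le_cross_succ hB n (ha.le.trans hlam) hstep
  have hc : 0 ≤ 2 * (lam (n + 1) / a - 1) := by
    have : 1 ≤ lam (n + 1) / a := (one_le_div ha).2 hlam
    linarith
  have hE' := mul_le_mul_of_nonneg_left hE hc
  have hX : B (r n) (anchor a lam y w n - xs) =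
      B (r n) (y n - xs) + (lam n / a - 1) * B (r n) (w n) := by
    rw [anchor, add_sub_right_comm]; simp
  have hD : B (anchor a lam y w (n + 1) - xs) (anchor a lam y w (n + 1) - xs) =
      B (anchor a lam y w n - xs) (anchor a lam y w n - xs)
        - 2 * (a + lam n - lam (n + 1)) * B (r n) (anchor a lam y w n - xs)
        + (a + lam n - lam (n + 1)) ^ 2 * B (r n) (r n) := by
    rw [h.anchor_succ ha.ne' n, sub_right_comm]
    generalize anchor a lam y w n - xs = X
    have hs : B X (r n) = B (r n) X := hB.eq _ _
    simp only [map_sub, map_smul, LinearMap.sub_apply, LinearMap.smul_apply, smul_eq_mul, hs]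
    ring
  have hxs' := mul_le_mul_of_nonneg_left hxs hα
  rw [hX] at hD
  unfold lyapunov
  rw [hD]
  generalize B (anchor a lam y w n - xs) (anchor a lam y w n - xs) = D
  generalize B (r n) (y n - xs) = P at *
  generalize B (r n) (w n) = Q at *
  generalize B (r n) (r n) = R at *
  generalize lam (n + 1) * (B (r (n + 1)) (w (n + 1)) - κ * B (r (n + 1)) (r (n + 1))) = S at *
  -- weights `2 (λ (n + 1) / a - 1)` and `2 (a + λ n - λ (n + 1))` eliminate the inner products
  refine sub_nonneg.1 (le_of_le_of_eq (add_nonneg (sub_nonneg.2 hE')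
    (mul_nonneg zero_le_two (sub_nonneg.2 hxs'))) ?_)
  field_simp
  ring

theorem lyapunov_zero (hw : w 0 = 0) (ha : a ≠ 0) (h0 : lam 0 = a) (xs : E) :
    lyapunov B κ a lam y r w xs 0 = B (y 0 - xs) (y 0 - xs) := by
  simp [lyapunov, anchor, hw, h0, ha]

/-- The Lyapunov function bounds the squared residual with weight `λ n ^ 2`, although its cross term
has no sign. -/
theorem residual_le_lyapunov (hB : B.IsSymm) (hpos : ∀ x, 0 ≤ B x x) (ha : 0 < a) (n : ℕ)
    (hlam : 0 ≤ lam n) {xs : E} (hxs : κ * B (r n) (r n) ≤ B (r n) (y n - xs)) :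
    (2 * κ - a) / a * lam n ^ 2 * B (r n) (r n) ≤ lyapunov B κ a lam y r w xs n := by
  have hX : B (r n) (anchor a lam y w n - xs) =
      B (r n) (y n - xs) + (lam n / a - 1) * B (r n) (w n) := by
    rw [anchor, add_sub_right_comm]; simp
  unfold lyapunov
  generalize anchor a lam y w n - xs = X at *
  -- the weight `λ n` makes the cross term of the square cancel that of the Lyapunov function
  have hsq := hpos (X - lam n • r n)
  have hs : B X (r n) = B (r n) X := hB.eq _ _
  simp only [map_sub, map_smul, LinearMap.sub_apply, LinearMap.smul_apply, smul_eq_mul, hs,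
    hX] at hsq
  have hxs' := mul_le_mul_of_nonneg_left hxs hlam
  simp only [map_sub] at hxs'
  refine sub_nonneg.1 (le_of_le_of_eq (add_nonneg hsq
    (mul_nonneg zero_le_two (sub_nonneg.2 hxs'))) ?_)
  field_simp
  ring

theorem IsRelaxedIteration.sum_add_lyapunov_le (h : IsRelaxedIteration κ a lam y r w)
    (hB : B.IsSymm) (ha : 0 < a) (h0 : lam 0 = a) (hlam : ∀ n, a ≤ lam n)
    (hα : ∀ n, 0 ≤ a + lam n - lam (n + 1)) {xs : E}
    (hstep : ∀ n,
      κ * B (r (n + 1) - r n) (r (n + 1) - r n) ≤ B (r (n + 1) - r n) (y (n + 1) - y n))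
    (hxs : ∀ n, κ * B (r n) (r n) ≤ B (r n) (y n - xs)) (n : ℕ) :
    ∑ k ∈ Finset.range n, (a + lam k - lam (k + 1)) * ((2 * κ - a) / a) *
        (2 * lam k - (a + lam k - lam (k + 1))) * B (r k) (r k)
      + lyapunov B κ a lam y r w xs n ≤ B (y 0 - xs) (y 0 - xs) := by
  induction n with
  | zero => simp [lyapunov_zero h.init_w ha.ne' h0]
  | succ n ih =>
    rw [Finset.sum_range_succ]
    have := h.lyapunov_succ_le hB ha n (hlam _) (hα n) (hstep n) (hxs n)
    linarith

theorem IsRelaxedIteration.residual_le (h : IsRelaxedIteration κ a lam y r w)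
    (hB : B.IsSymm) (hpos : ∀ x, 0 ≤ B x x) (ha : 0 < a) (haκ : a < 2 * κ) (h0 : lam 0 = a)
    (hlam : ∀ n, a ≤ lam n) (hα : ∀ n, 0 ≤ a + lam n - lam (n + 1)) {xs : E}
    (hstep : ∀ n,
      κ * B (r (n + 1) - r n) (r (n + 1) - r n) ≤ B (r (n + 1) - r n) (y (n + 1) - y n))
    (hxs : ∀ n, κ * B (r n) (r n) ≤ B (r n) (y n - xs)) (n : ℕ) :
    (2 * κ - a) / a * lam n ^ 2 * B (r n) (r n) ≤ B (y 0 - xs) (y 0 - xs) := by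
  have h1 := h.sum_add_lyapunov_le hB ha h0 hlam hα hstep hxs n
  have h2 := residual_le_lyapunov (y := y) (w := w) hB hpos ha n (ha.le.trans (hlam n)) (hxs n)
  have h3 : 0 ≤ ∑ k ∈ Finset.range n, (a + lam k - lam (k + 1)) * ((2 * κ - a) / a) *
      (2 * lam k - (a + lam k - lam (k + 1))) * B (r k) (r k) := by
    refine Finset.sum_nonneg fun k _ => mul_nonneg (mul_nonneg (mul_nonneg (hα k)
      (div_nonneg (by linarith) ha.le)) ?_) (hpos _)
    linarith [hlam k, hlam (k + 1)]
  linarith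

theorem IsRelaxedIteration.summable_residual (h : IsRelaxedIteration κ a lam y r w)
    (hB : B.IsSymm) (hpos : ∀ x, 0 ≤ B x x) (ha : 0 < a) (haκ : a < 2 * κ) (h0 : lam 0 = a)
    (hlam : ∀ n, a ≤ lam n) {δ : ℝ} (hδ : 0 < δ) (hα : ∀ n, δ ≤ a + lam n - lam (n + 1)) {xs : E}
    (hstep : ∀ n,
      κ * B (r (n + 1) - r n) (r (n + 1) - r n) ≤ B (r (n + 1) - r n) (y (n + 1) - y n))
    (hxs : ∀ n, κ * B (r n) (r n) ≤ B (r n) (y n - xs)) :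
    Summable fun n => B (r n) (r n) := by
  have hc : 0 < δ * ((2 * κ - a) / a) * a := by
    have : 0 < (2 * κ - a) / a := div_pos (by linarith) ha
    positivity
  suffices Summable fun n => δ * ((2 * κ - a) / a) * a * B (r n) (r n) from
    (summable_mul_left_iff hc.ne').1 this
  refine summable_of_sum_range_le (c := B (y 0 - xs) (y 0 - xs))
    (fun n => mul_nonneg hc.le (hpos _)) fun n => ?_
  have h1 := h.sum_add_lyapunov_le hB ha h0 hlam (fun n => hδ.le.trans (hα n)) hstep hxs n
  have h2 := residual_le_lyapunov (y := y) (w := w) hB hpos ha n (ha.le.trans (hlam n)) (hxs n)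
  have h3 : 0 ≤ (2 * κ - a) / a * lam n ^ 2 * B (r n) (r n) :=
    mul_nonneg (mul_nonneg (div_nonneg (by linarith) ha.le) (sq_nonneg _)) (hpos _)
  refine le_trans (Finset.sum_le_sum fun k _ => ?_) (by linarith)
  refine mul_le_mul_of_nonneg_right ?_ (hpos _)
  have h4 : 0 ≤ (2 * κ - a) / a := div_nonneg (by linarith) ha.le
  -- the bracket equals `λ k + λ (k + 1) - a`
  have h5 : a ≤ 2 * lam k - (a + lam k - lam (k + 1)) := by linarith [hlam k, hlam (k + 1)]
  have h6 : δ * ((2 * κ - a) / a) ≤ (a + lam k - lam (k + 1)) * ((2 * κ - a) / a) :=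
    mul_le_mul_of_nonneg_right (hα k) h4
  exact mul_le_mul h6 h5 ha.le (le_trans (mul_nonneg hδ.le h4) h6)

end Bilinear

/-! ### The form of `M` and cocoercivity of the forward-backward residual -/

section Metric

variable {H : Type*} [NormedAddCommGroup H] [InnerProductSpace ℝ H]

/-- The bilinear form `⟨x, M y⟩`, whose square norm is `‖x‖_M ^ 2`. -/
noncomputable def bilinM (M : H →L[ℝ] H) : LinearMap.BilinForm ℝ H :=
  (innerₗ H).compl₂ (M : H →ₗ[ℝ] H)

@[simp]
theorem bilinM_apply (M : H →L[ℝ] H) (x y : H) : bilinM M x y = ⟪x, M y⟫_ℝ := rfl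

variable [CompleteSpace H] {M : H →L[ℝ] H}

theorem IsStronglyPositive.inner_apply_comm (hM : IsStronglyPositive M) (x y : H) :
    ⟪M x, y⟫_ℝ = ⟪x, M y⟫_ℝ := hM.1.isSymmetric x y

theorem IsStronglyPositive.isSymm_bilinM (hM : IsStronglyPositive M) : (bilinM M).IsSymm :=
  ⟨fun x y => by
    rw [bilinM_apply, bilinM_apply, ← hM.inner_apply_comm y x, real_inner_comm]⟩

theorem IsStronglyPositive.inner_self_nonneg (hM : IsStronglyPositive M) (x : H) :
    0 ≤ ⟪x, M x⟫_ℝ := by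
  obtain ⟨c, hc, h⟩ := hM.2
  exact le_trans (by positivity) (h x)

theorem IsStronglyPositive.normM_sq (hM : IsStronglyPositive M) (x : H) :
    normM M x ^ 2 = bilinM M x x := Real.sq_sqrt (hM.inner_self_nonneg x)

theorem IsStronglyPositive.eq_zero_of_bilinM_nonpos (hM : IsStronglyPositive M) {x : H}
    (hx : bilinM M x x ≤ 0) : x = 0 := by
  obtain ⟨c, hc, h⟩ := hM.2
  have h0 : ‖x‖ ^ 2 ≤ 0 := nonpos_of_mul_nonpos_right ((h x).trans hx) hc
  simpa using le_antisymm h0 (sq_nonneg _)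

theorem IsStronglyPositive.isInvertible (hM : IsStronglyPositive M) : M.IsInvertible := by
  obtain ⟨c, hc, h⟩ := hM.2
  obtain ⟨u, rfl⟩ := M.isUnit_of_forall_le_norm_inner_map (c := ⟨c, hc.le⟩) hc fun x => by
    rw [real_inner_comm, mul_comm]
    exact (h x).trans (le_abs_self _)
  exact ⟨ContinuousLinearEquiv.ofUnit u, rfl⟩

theorem IsStronglyPositive.apply_inverse (hM : IsStronglyPositive M) (x : H) :
    M (M.inverse x) = x := hM.isInvertible.self_apply_inverse x

variable {C : H → H} {β : ℝ}

/-- Cocoercivity of `C` in terms of `M⁻¹ C`, which involves only the form of `M`. -/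
theorem IsCocoercive.bilinM_le (hC : IsCocoercive M β C) (hM : IsStronglyPositive M) (x y : H) :
    bilinM M (M.inverse (C x) - M.inverse (C y)) (M.inverse (C x) - M.inverse (C y)) ≤
      β * bilinM M (M.inverse (C x) - M.inverse (C y)) (x - y) := by
  have h := hC x y
  have e : ⟪C x - C y, M.inverse (C x - C y)⟫_ℝ =
      bilinM M (M.inverse (C x) - M.inverse (C y)) (M.inverse (C x) - M.inverse (C y)) := by
    rw [← map_sub, bilinM_apply, hM.apply_inverse, real_inner_comm]
  have e' : ⟪C x - C y, x - y⟫_ℝ =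
      bilinM M (M.inverse (C x) - M.inverse (C y)) (x - y) := by
    rw [← map_sub, bilinM_apply, ← hM.inner_apply_comm, hM.apply_inverse]
  rwa [normM, Real.sq_sqrt (e ▸ hM.inner_self_nonneg _), e, e'] at h

theorem IsCocoercive.exists_norm_sq_le (hC : IsCocoercive M β C) (hM : IsStronglyPositive M) :
    ∃ k : ℝ, 0 < k ∧ ∀ x y, k * ‖C x - C y‖ ^ 2 ≤ β * ⟪C x - C y, x - y⟫_ℝ := by
  obtain ⟨c, hc, h⟩ := hM.2
  refine ⟨c / (‖M‖ + 1) ^ 2, by positivity, fun x y => ?_⟩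
  have h1 := hC.bilinM_le hM x y
  rw [← map_sub] at h1
  set u := M.inverse (C x - C y) with hu
  have hCu : C x - C y = M u := (hM.apply_inverse _).symm
  rw [bilinM_apply, bilinM_apply, ← hM.inner_apply_comm u (x - y), ← hCu] at h1
  refine le_trans ?_ h1
  refine le_trans ?_ ((h u).trans_eq (by rw [← hCu]))
  rw [div_mul_eq_mul_div, div_le_iff₀ (by positivity), mul_assoc]
  refine mul_le_mul_of_nonneg_left ?_ hc.le
  rw [← mul_pow, hCu]
  refine pow_le_pow_left₀ (norm_nonneg _) ?_ 2
  nlinarith [M.le_opNorm u, norm_nonneg u]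

theorem IsCocoercive.inner_nonneg (hC : IsCocoercive M β C) (hM : IsStronglyPositive M)
    (hβ : 0 ≤ β) (x y : H) : 0 ≤ ⟪C x - C y, x - y⟫_ℝ := by
  obtain ⟨k, hk, h⟩ := hC.exists_norm_sq_le hM
  rcases hβ.eq_or_lt with rfl | hβ
  · have h0 : ‖C x - C y‖ ^ 2 ≤ 0 :=
      nonpos_of_mul_nonpos_right ((h x y).trans_eq (zero_mul _)) hk
    have : C x - C y = 0 := by simpa using le_antisymm h0 (sq_nonneg _)
    simp [this]
  · exact nonneg_of_mul_nonneg_right ((mul_nonneg hk.le (sq_nonneg _)).trans (h x y)) hβ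

theorem IsCocoercive.mono (hC : IsCocoercive M β C) (hM : IsStronglyPositive M) (hβ : 0 ≤ β)
    {βb : ℝ} (hβb : β ≤ βb) : IsCocoercive M βb C := fun x y =>
  (hC x y).trans (mul_le_mul_of_nonneg_right hβb (hC.inner_nonneg hM hβ x y))

variable {A : H → Set H} {γ : ℝ}

omit [CompleteSpace H] in
theorem mem_fbStep_of_mem_zer {xs : H} (h : xs ∈ zer A C) : xs ∈ fbStep M A C γ xs := by
  obtain ⟨a, ha, h0⟩ := h
  exact ⟨a, ha, by rw [eq_neg_of_add_eq_zero_left h0]; module⟩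

/-- The residual `y - p` of the forward-backward step is a `(1 - γ β / 4)`-cocoercive function of
`y` in the metric of `M`. -/
theorem fbStep_cocoercive (hM : IsStronglyPositive M) (hA : IsMonotoneOp A)
    (hC : IsCocoercive M β C) (hγ : 0 < γ) (hβ : 0 ≤ β) {y p y' p' : H}
    (hp : p ∈ fbStep M A C γ y) (hp' : p' ∈ fbStep M A C γ y') :
    (1 - γ * β / 4) * bilinM M ((y - p) - (y' - p')) ((y - p) - (y' - p')) ≤
      bilinM M ((y - p) - (y' - p')) (y - y') := by
  obtain ⟨a, ha, h⟩ := hp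
  obtain ⟨a', ha', h'⟩ := hp'
  have hc := hC.bilinM_le hM y y'
  set u := M.inverse (C y) - M.inverse (C y') with hu
  have hCu : C y - C y' = M u := by rw [hu, map_sub, hM.apply_inverse, hM.apply_inverse]
  have hmon := mul_nonneg hγ.le (hA _ _ _ _ ha ha')
  have hM' : γ • (a - a') = M (((y - p) - (y' - p')) - γ • u) := by
    rw [smul_sub, eq_sub_of_add_eq' h, eq_sub_of_add_eq' h', map_sub M (y - p - (y' - p')),
      map_smul, ← hCu]
    simp only [map_sub]
    module
  rw [← real_inner_smul_left, hM', hM.inner_apply_comm, ← bilinM_apply,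
    show p - p' = (y - y') - ((y - p) - (y' - p')) by abel] at hmon
  set r := (y - p) - (y' - p')
  set d := y - y'
  have hur : bilinM M u r = bilinM M r u := hM.isSymm_bilinM.eq _ _
  rcases hβ.eq_or_lt with rfl | hβ
  · have hu0 : u = 0 := hM.eq_zero_of_bilinM_nonpos (by simpa using hc)
    simp only [hu0, smul_zero, sub_zero, map_sub] at hmon
    linarith
  · -- completing the square in `u - (β / 2) r`
    have hsq : 0 ≤ bilinM M (u - (β / 2) • r) (u - (β / 2) • r) := hM.inner_self_nonneg _
    simp only [map_sub, map_smul, LinearMap.sub_apply, LinearMap.smul_apply, smul_eq_mul,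
      hur] at hmon hsq
    have h1 : 0 ≤ β * bilinM M u d - bilinM M u u := sub_nonneg.2 hc
    refine sub_nonneg.1 (le_of_le_of_eq (add_nonneg hmon
      (mul_nonneg (div_nonneg hγ.le hβ.le) (add_nonneg hsq h1))) ?_)
    field_simp
    ring

end Metric

/-! ### Weak limits and Opial's argument -/

section Weak

variable {H : Type*} [NormedAddCommGroup H] [InnerProductSpace ℝ H]

/-- A maximally monotone operator contains every pair that is monotonically related to its graph. -/
theorem IsMaximallyMonotone.mem {A : H → Set H} (hA : IsMaximallyMonotone A) {x v : H}
    (h : ∀ u, ∀ w ∈ A u, 0 ≤ ⟪v - w, x - u⟫_ℝ) : v ∈ A x := by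
  -- adding the pair `(x, v)` to the graph keeps it monotone
  have hB := hA.2 (fun u => A u ∪ {w | u = x ∧ w = v}) ?_ fun u => Set.subset_union_left
  · rw [← hB]
    exact Or.inr ⟨rfl, rfl⟩
  · rintro a u b w (hu | ⟨rfl, rfl⟩) (hw | ⟨rfl, rfl⟩)
    · exact hA.1 _ _ _ _ hu hw
    · rw [← inner_neg_neg, neg_sub, neg_sub]
      exact h _ _ hu
    · exact h _ _ hw
    · simp

theorem tendsto_inner_of_tendsto_of_weak {ι : Type*} {l : Filter ι} {f q : ι → H} {f₀ x : H}
    {R : ℝ} (hf : Tendsto f l (𝓝 f₀)) (hR : ∀ i, ‖q i‖ ≤ R)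
    (hq : ∀ h, Tendsto (fun i => ⟪h, q i⟫_ℝ) l (𝓝 ⟪h, x⟫_ℝ)) :
    Tendsto (fun i => ⟪f i, q i⟫_ℝ) l (𝓝 ⟪f₀, x⟫_ℝ) := by
  have h0 : Tendsto (fun i => ⟪f i - f₀, q i⟫_ℝ) l (𝓝 0) := by
    have h1 : Tendsto (fun i => ‖f i - f₀‖ * R) l (𝓝 0) := by
      simpa using (tendsto_iff_norm_sub_tendsto_zero.1 hf).mul_const R
    refine squeeze_zero_norm (fun i => ?_) h1
    exact (norm_inner_le_norm _ _).trans (mul_le_mul_of_nonneg_left (hR i) (norm_nonneg _))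
  refine (by simpa using h0.add (hq f₀) : Tendsto _ l _).congr fun i => ?_
  rw [← inner_add_left, sub_add_cancel]

theorem weaklyConverges_iff [CompleteSpace H] {x : ℕ → H} {z : H} :
    WeaklyConverges x z ↔ ∀ h, Tendsto (fun n => ⟪h, x n⟫_ℝ) atTop (𝓝 ⟪h, z⟫_ℝ) := by
  refine (WeakBilin.tendsto_iff_forall_eval_tendsto (topDualPairing ℝ H).flip ?_).trans ?_
  · intro u v huv
    refine ext_inner_left ℝ fun h => ?_
    exact DFunLike.congr_fun huv (innerSL ℝ h)
  · refine ⟨fun hx h => hx (innerSL ℝ h), fun hx f => ?_⟩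
    have := hx ((InnerProductSpace.toDual ℝ H).symm f)
    simp only [InnerProductSpace.toDual_symm_apply] at this
    exact this

/-- Weak compactness of bounded sets: by the Banach-Alaoglu theorem and the Riesz representation, a
bounded family has a weak limit along every ultrafilter. -/
theorem exists_weak_limit_ultrafilter [CompleteSpace H] {ι : Type*} (U : Ultrafilter ι)
    {q : ι → H} {R : ℝ} (hR : ∀ i, ‖q i‖ ≤ R) :
    ∃ x : H, ∀ h, Tendsto (fun i => ⟪h, q i⟫_ℝ) U (𝓝 ⟪h, x⟫_ℝ) := by
  obtain ⟨f, -, hf⟩ := (WeakDual.isCompact_closedBall (𝕜 := ℝ) (E := H) 0 R).ultrafilter_le_nhds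
    (U.map fun i => StrongDual.toWeakDual (InnerProductSpace.toDual ℝ H (q i))) <| by
      rw [le_principal_iff]
      refine Filter.mem_map.2 (Filter.univ_mem' fun i => ?_)
      simpa using hR i
  refine ⟨(InnerProductSpace.toDual ℝ H).symm (WeakDual.toStrongDual f), fun h => ?_⟩
  have h1 := ((WeakDual.eval_continuous (𝕜 := ℝ) h).tendsto f).mono_left hf
  rw [real_inner_comm, InnerProductSpace.toDual_symm_apply]
  exact (tendsto_map'_iff.1 h1).congr fun i => real_inner_comm _ _

variable [CompleteSpace H] {M : H →L[ℝ] H}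

theorem IsStronglyPositive.norm_le_of_bilinM_le (hM : IsStronglyPositive M) {D : ℝ} :
    ∃ R, ∀ x, bilinM M x x ≤ D → ‖x‖ ≤ R := by
  obtain ⟨c, hc, h⟩ := hM.2
  refine ⟨√(D / c), fun x hx => Real.le_sqrt_of_sq_le ?_⟩
  rw [le_div_iff₀ hc, mul_comm]
  exact (h x).trans hx

/-- Opial's argument: a sequence that is Fejér monotone in the metric of `M` with respect to a
nonempty set containing all its weak limit points converges weakly to a point of that set. -/
theorem opial (hM : IsStronglyPositive M) {q : ℕ → H} {Z : Set H} (hZ : Z.Nonempty)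
    (hfejer : ∀ z ∈ Z, Antitone fun n => bilinM M (q n - z) (q n - z))
    (hcluster : ∀ U : Ultrafilter ℕ, ↑U ≤ (atTop : Filter ℕ) → ∀ x,
      (∀ h, Tendsto (fun n => ⟪h, q n⟫_ℝ) U (𝓝 ⟪h, x⟫_ℝ)) → x ∈ Z) :
    ∃ z ∈ Z, WeaklyConverges q z := by
  obtain ⟨z₀, hz₀⟩ := hZ
  obtain ⟨R, hR⟩ := hM.norm_le_of_bilinM_le (D := bilinM M (q 0 - z₀) (q 0 - z₀))
  have hbdd : ∀ n, ‖q n‖ ≤ R + ‖z₀‖ := fun n => by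
    have := hR _ (hfejer z₀ hz₀ (Nat.zero_le n))
    have h2 := norm_add_le (q n - z₀) z₀
    rw [sub_add_cancel] at h2
    linarith
  have hlim : ∀ z ∈ Z, ∃ ℓ, Tendsto (fun n => bilinM M (q n - z) (q n - z)) atTop (𝓝 ℓ) :=
    fun z hz => ⟨_, tendsto_atTop_ciInf (hfejer z hz) ⟨0, by
      rintro _ ⟨n, rfl⟩
      exact hM.inner_self_nonneg _⟩⟩
  choose! ℓ hℓ using hlim
  -- `⟨q n, M (z - z')⟩` converges for any two points of `Z`, so weak limits in `Z` coincide
  have hdiff : ∀ z ∈ Z, ∀ z' ∈ Z, ∃ m, Tendsto (fun n => ⟪M (z - z'), q n⟫_ℝ) atTop (𝓝 m) := by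
    intro z hz z' hz'
    refine ⟨(ℓ z' - ℓ z + bilinM M z z - bilinM M z' z') / 2,
      (((((hℓ z' hz').sub (hℓ z hz)).add_const _).sub_const _).div_const 2).congr fun n => ?_⟩
    have h1 : bilinM M z (q n) = bilinM M (q n) z := hM.isSymm_bilinM.eq _ _
    have h2 : bilinM M z' (q n) = bilinM M (q n) z' := hM.isSymm_bilinM.eq _ _
    rw [real_inner_comm, ← bilinM_apply]
    simp only [map_sub, LinearMap.sub_apply, h1, h2]
    ring
  choose x hx using fun U : Ultrafilter ℕ => exists_weak_limit_ultrafilter U hbdd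
  have huniq : ∀ U V : Ultrafilter ℕ, ↑U ≤ (atTop : Filter ℕ) → ↑V ≤ (atTop : Filter ℕ) →
      x U = x V := by
    intro U V hU hV
    obtain ⟨m, hm⟩ := hdiff _ (hcluster U hU _ (hx U)) _ (hcluster V hV _ (hx V))
    have e1 := tendsto_nhds_unique (hx U (M (x U - x V))) (hm.mono_left hU)
    have e2 := tendsto_nhds_unique (hx V (M (x U - x V))) (hm.mono_left hV)
    refine sub_eq_zero.1 (hM.eq_zero_of_bilinM_nonpos (le_of_eq ?_))
    rw [bilinM_apply, real_inner_comm, inner_sub_right, e1, e2, sub_self]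
  -- the common weak limit along all ultrafilters is the weak limit of the sequence
  obtain ⟨U₀, hU₀⟩ := Ultrafilter.exists_le (atTop : Filter ℕ)
  refine ⟨x U₀, hcluster U₀ hU₀ _ (hx U₀), weaklyConverges_iff.2 fun h => ?_⟩
  refine (tendsto_iff_ultrafilter _ _ _).2 fun V hV => ?_
  rw [huniq U₀ V hU₀ hV]
  exact hx V h

/-- Demiclosedness: weak limits of forward-backward points with residuals tending to zero are zeros
of `A + C`. -/
theorem mem_zer_of_weak_limit (hM : IsStronglyPositive M) {A : H → Set H} {C : H → H} {β γ R : ℝ}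
    (hA : IsMaximallyMonotone A) (hC : IsCocoercive M β C) (hβ : 0 ≤ β) (hγ : 0 < γ)
    (hzer : (zer A C).Nonempty) {ι : Type*} {l : Filter ι} [l.NeBot] {y p : ι → H} {x : H}
    (hp : ∀ i, p i ∈ fbStep M A C γ (y i)) (hyR : ∀ i, ‖y i‖ ≤ R) (hpR : ∀ i, ‖p i‖ ≤ R)
    (hr : Tendsto (fun i => y i - p i) l (𝓝 0))
    (hx : ∀ h, Tendsto (fun i => ⟪h, p i⟫_ℝ) l (𝓝 ⟪h, x⟫_ℝ)) : x ∈ zer A C := by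
  obtain ⟨xs, as, has, hs0⟩ := hzer
  obtain rfl : as = -C xs := eq_neg_of_add_eq_zero_left hs0
  obtain ⟨k, hk, hCk⟩ := hC.exists_norm_sq_le hM
  choose a ha hap using hp
  have hγa : ∀ i, a i = γ⁻¹ • M (y i - p i) - C (y i) := fun i => by
    rw [map_sub, eq_inv_smul_iff₀ hγ.ne' |>.2 (eq_sub_of_add_eq' (hap i))]
    rw [show M (y i) - γ • C (y i) - M (p i) = (M (y i) - M (p i)) - γ • C (y i) by abel,
      smul_sub, inv_smul_smul₀ hγ.ne']
  -- `y` and `p` have the same weak limit, since their difference tends to zero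
  have hyx : ∀ h, Tendsto (fun i => ⟪h, y i⟫_ℝ) l (𝓝 ⟪h, x⟫_ℝ) := fun h => by
    have h1 := ((tendsto_const_nhds (x := h)).inner hr (𝕜 := ℝ)).add (hx h)
    rw [inner_zero_right, zero_add] at h1
    exact h1.congr fun i => by rw [← inner_add_right, sub_add_cancel]
  have hMr : Tendsto (fun i => γ⁻¹ • M (y i - p i)) l (𝓝 0) := by
    simpa using ((M.continuous.tendsto 0).comp hr).const_smul γ⁻¹
  have hxsR : ∀ z : H, ‖z‖ ≤ R → ‖z - xs‖ ≤ R + ‖xs‖ := fun z hz =>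
    (norm_sub_le _ _).trans (by gcongr)
  -- `C (y i)` converges strongly, which compensates for the weak convergence of `y i`
  have hCy : Tendsto (fun i => C (y i)) l (𝓝 (C xs)) := by
    have hLip : ∀ i, ‖C (y i) - C xs‖ ≤ β / k * (R + ‖xs‖) := fun i => by
      have h1 : k * ‖C (y i) - C xs‖ ^ 2 ≤ β * (‖C (y i) - C xs‖ * (R + ‖xs‖)) :=
        (hCk _ _).trans (mul_le_mul_of_nonneg_left ((real_inner_le_norm _ _).trans
          (mul_le_mul_of_nonneg_left (hxsR _ (hyR i)) (norm_nonneg _))) hβ)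
      rcases (norm_nonneg (C (y i) - C xs)).eq_or_lt with h0 | h0
      · rw [← h0]
        have : 0 ≤ R := (norm_nonneg _).trans (hyR i)
        positivity
      · rw [div_mul_eq_mul_div, le_div_iff₀ hk]
        refine le_of_mul_le_mul_right ?_ h0
        linarith
    -- monotonicity of `A` against the pair `(xs, -C xs)` bounds `⟨C (y i) - C xs, p i - xs⟩`
    have hsq : ∀ i, ‖C (y i) - C xs‖ ^ 2 ≤
        (β * (‖γ⁻¹ • M (y i - p i)‖ * (R + ‖xs‖) + β / k * (R + ‖xs‖) * ‖y i - p i‖)) / k :=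
      fun i => by
        rw [le_div_iff₀ hk, mul_comm]
        refine (hCk _ _).trans (mul_le_mul_of_nonneg_left ?_ hβ)
        have h1 := hA.1 _ _ _ _ (ha i) has
        rw [hγa, sub_neg_eq_add, sub_add, inner_sub_left] at h1
        have h2 := (real_inner_le_norm (γ⁻¹ • M (y i - p i)) (p i - xs)).trans
          (mul_le_mul_of_nonneg_left (hxsR _ (hpR i)) (norm_nonneg _))
        have h3 := (real_inner_le_norm (C (y i) - C xs) (y i - p i)).trans
          (mul_le_mul_of_nonneg_right (hLip i) (norm_nonneg _))
        rw [show y i - xs = (p i - xs) + (y i - p i) by abel, inner_add_right]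
        linarith
    have h0 : Tendsto (fun i => (β * (‖γ⁻¹ • M (y i - p i)‖ * (R + ‖xs‖)
        + β / k * (R + ‖xs‖) * ‖y i - p i‖)) / k) l (𝓝 0) := by
      simpa using (((hMr.norm.mul_const (R + ‖xs‖)).add
        (hr.norm.const_mul (β / k * (R + ‖xs‖)))).const_mul β).div_const k
    have h1 := squeeze_zero (fun i => sq_nonneg _) hsq h0
    rw [tendsto_iff_norm_sub_tendsto_zero]
    have h2 := h1.sqrt
    simpa [Real.sqrt_sq] using h2
  have hax : -C xs ∈ A x := by
    refine hA.mem fun u w hw => ?_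
    have h1 : Tendsto (fun i => a i - w) l (𝓝 (-C xs - w)) := by
      simpa [hγa] using (hMr.sub hCy).sub_const w
    have h2 := (tendsto_inner_of_tendsto_of_weak h1 hpR hx).sub
      (h1.inner (tendsto_const_nhds (x := u)) (𝕜 := ℝ))
    rw [← inner_sub_right] at h2
    refine ge_of_tendsto' h2 fun i => ?_
    rw [← inner_sub_right]
    exact hA.1 _ _ _ _ (ha i) hw
  -- cocoercivity between `y i` and `x` passes to the limit, where its right-hand side vanishes
  have hCx : C xs = C x := by
    have h1 : Tendsto (fun i => C (y i) - C x) l (𝓝 (C xs - C x)) := hCy.sub_const _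
    have h2 := (tendsto_inner_of_tendsto_of_weak h1 hyR hyx).sub
      (h1.inner (tendsto_const_nhds (x := x)) (𝕜 := ℝ))
    rw [sub_self] at h2
    have h3 := le_of_tendsto_of_tendsto' ((h1.norm.pow 2).const_mul k) (h2.const_mul β)
      fun i => by
        rw [← inner_sub_right]
        exact hCk (y i) x
    rw [mul_zero] at h3
    have h4 : ‖C xs - C x‖ ^ 2 ≤ 0 := nonpos_of_mul_nonpos_right h3 hk
    exact sub_eq_zero.1 (by simpa using le_antisymm h4 (sq_nonneg _))
  exact ⟨-C xs, hax, by rw [hCx, neg_add_cancel]⟩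

end Weak

/-! ### The relaxation sequence -/

section Relaxation

variable {γ βb e : ℝ}

theorem tunableLam_zero : tunableLam γ βb e 0 = (1 - γ * βb / 4) ^ e := by
  simp [tunableLam]

theorem tunableLam_one_right (n : ℕ) : tunableLam γ βb 1 n = (1 - γ * βb / 4) * (1 + n) := by
  simp [tunableLam]

theorem tunableLam_zero_right (n : ℕ) : tunableLam γ βb 0 n = 1 := by
  simp [tunableLam]

theorem le_tunableLam (he : 0 ≤ e) (ha : 0 ≤ (1 - γ * βb / 4) ^ e) (n : ℕ) :
    (1 - γ * βb / 4) ^ e ≤ tunableLam γ βb e n :=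
  le_mul_of_one_le_right ha (Real.one_le_rpow (by simp) he)

/-- Bernoulli's inequality gives `(n + 2) ^ e - (n + 1) ^ e ≤ e (n + 1) ^ (e - 1) ≤ e`. -/
theorem tunableLam_succ_sub_le (he : 0 ≤ e) (he' : e ≤ 1) (ha : 0 ≤ (1 - γ * βb / 4) ^ e)
    (n : ℕ) :
    tunableLam γ βb e (n + 1) - tunableLam γ βb e n ≤ (1 - γ * βb / 4) ^ e * e := by
  unfold tunableLam
  rw [← mul_sub]
  refine mul_le_mul_of_nonneg_left ?_ ha
  have hx : (0 : ℝ) < 1 + n := by positivity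
  have hfac : (1 : ℝ) + ((n + 1 : ℕ) : ℝ) = (1 + n) * (1 + (1 + (n : ℝ))⁻¹) := by
    push_cast; field_simp; ring
  have hbern : (1 + (1 + (n : ℝ))⁻¹) ^ e ≤ 1 + e * (1 + (n : ℝ))⁻¹ :=
    rpow_one_add_le_one_add_mul_self (by have := inv_pos.2 hx; linarith) he he'
  have hle : (1 + (n : ℝ)) ^ e ≤ 1 + n :=
    (Real.rpow_le_rpow_of_exponent_le (by simp) he').trans_eq (Real.rpow_one _)
  rw [hfac, Real.mul_rpow hx.le (by positivity)]
  have h1 := mul_le_mul_of_nonneg_left hbern (Real.rpow_nonneg hx.le e)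
  have h2 : (1 + (n : ℝ)) ^ e * (1 + (n : ℝ))⁻¹ ≤ 1 := by
    rw [← div_eq_mul_inv]
    exact (div_le_one hx).2 hle
  nlinarith

end Relaxation

variable {H : Type*} [NormedAddCommGroup H] [InnerProductSpace ℝ H]

/-! ### The interpolating forward-backward algorithm -/

section Algorithm

variable {M : H →L[ℝ] H} {A : H → Set H} {C : H → H} {γ β βb e : ℝ} {lam : ℕ → ℝ} {y p : ℤ → H}

theorem IsInterpolatingFB.isRelaxedIteration (h : IsInterpolatingFB M A C γ βb lam y p)
    (hlam : ∀ n, lam (n + 1) ≠ 0) :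
    IsRelaxedIteration (1 - γ * βb / 4) (lam 0) lam (fun n : ℕ => y n) (fun n : ℕ => y n - p n)
      (fun n : ℕ => y n - y (n - 1) + (2 * (1 - γ * βb / 4)) • (y (n - 1) - p (n - 1))) where
  init_w := by simp [h.init_y, h.init_p]
  step_y n := by
    simp only [Nat.cast_add, Nat.cast_one, add_sub_cancel_right]
    module
  step_w n := by
    simp only [Nat.cast_add, Nat.cast_one, add_sub_cancel_right]
    rw [h.step_y n]
    have := hlam n
    match_scalars <;> field_simp <;> ring

variable [CompleteSpace H]

theorem IsInterpolatingFB.cocoercive_succ (h : IsInterpolatingFB M A C γ βb lam y p)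
    (hM : IsStronglyPositive M) (hA : IsMonotoneOp A) (hC : IsCocoercive M βb C) (hγ : 0 < γ)
    (hβb : 0 ≤ βb) (n : ℕ) :
    (1 - γ * βb / 4) * bilinM M
        ((y (n + 1 : ℕ) - p (n + 1 : ℕ)) - (y n - p n))
        ((y (n + 1 : ℕ) - p (n + 1 : ℕ)) - (y n - p n)) ≤
      bilinM M ((y (n + 1 : ℕ) - p (n + 1 : ℕ)) - (y n - p n)) (y (n + 1 : ℕ) - y n) :=
  fbStep_cocoercive hM hA hC hγ hβb (h.step_p (n + 1)) (h.step_p n)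

theorem IsInterpolatingFB.cocoercive_zer (h : IsInterpolatingFB M A C γ βb lam y p)
    (hM : IsStronglyPositive M) (hA : IsMonotoneOp A) (hC : IsCocoercive M βb C) (hγ : 0 < γ)
    (hβb : 0 ≤ βb) {xs : H} (hxs : xs ∈ zer A C) (n : ℕ) :
    (1 - γ * βb / 4) * bilinM M (y n - p n) (y n - p n) ≤ bilinM M (y n - p n) (y n - xs) := by
  simpa only [sub_self, sub_zero] using
    fbStep_cocoercive hM hA hC hγ hβb (h.step_p n) (mem_fbStep_of_mem_zer hxs)

theorem IsStronglyPositive.normM_smul_sub_sq (hM : IsStronglyPositive M) (γ : ℝ) (x z : H) :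
    normM M ((1 / γ) • (x - z)) ^ 2 = bilinM M (z - x) (z - x) / γ ^ 2 := by
  rw [hM.normM_sq, ← neg_sub z x]
  simp only [map_neg, map_smul, LinearMap.neg_apply, LinearMap.smul_apply, smul_eq_mul]
  ring

theorem IsInterpolatingFB.normM_residual_sq_le
    (h : IsInterpolatingFB M A C γ βb (tunableLam γ βb e) y p)
    (hM : IsStronglyPositive M) (hA : IsMonotoneOp A) (hC : IsCocoercive M βb C) (hγ : 0 < γ)
    (hβb : 0 ≤ βb) (he : 0 ≤ e) (he' : e ≤ 1) (ha : 0 < (1 - γ * βb / 4) ^ e)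
    (ha' : 2 * (1 - γ * βb / 4) ^ e < 4 - γ * βb) {xs : H} (hxs : xs ∈ zer A C) (n : ℕ) :
    normM M ((1 / γ) • (p n - y n)) ^ 2 ≤ 2 * normM M (y 0 - xs) ^ 2 /
      (γ ^ 2 * (4 - γ * βb - 2 * (1 - γ * βb / 4) ^ e) * (1 - γ * βb / 4) ^ e
        * (1 + (n : ℝ)) ^ (2 * e)) := by
  have hlam := le_tunableLam (γ := γ) (βb := βb) he ha.le
  have hrel := h.isRelaxedIteration fun n => (ha.trans_le (hlam (n + 1))).ne'
  rw [tunableLam_zero] at hrel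
  have key := hrel.residual_le hM.isSymm_bilinM hM.inner_self_nonneg ha (by linarith)
    tunableLam_zero hlam
    (fun n => by
      have := tunableLam_succ_sub_le (γ := γ) (βb := βb) he he' ha.le n
      nlinarith)
    (h.cocoercive_succ hM hA hC hγ hβb) (h.cocoercive_zer hM hA hC hγ hβb hxs) n
  rw [hM.normM_smul_sub_sq, hM.normM_sq]
  have hpow : (1 + (n : ℝ)) ^ (2 * e) = ((1 + (n : ℝ)) ^ e) ^ 2 := by
    rw [mul_comm, Real.rpow_mul (by positivity), Real.rpow_two]
  have hn : (0 : ℝ) < (1 + (n : ℝ)) ^ e := by positivity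
  rw [hpow]
  have key' : (2 * (1 - γ * βb / 4) - (1 - γ * βb / 4) ^ e) * (1 - γ * βb / 4) ^ e *
      ((1 + (n : ℝ)) ^ e) ^ 2 * bilinM M (y n - p n) (y n - p n) ≤
      bilinM M (y 0 - xs) (y 0 - xs) := by
    refine le_of_eq_of_le ?_ key
    unfold tunableLam
    field_simp
  set a := (1 - γ * βb / 4) ^ e
  have hpos : 0 < 4 - γ * βb - 2 * a := by linarith
  rw [div_le_div_iff₀ (by positivity) (by positivity)]
  have := mul_le_mul_of_nonneg_left key' (by positivity : 0 ≤ 2 * γ ^ 2)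
  linarith

theorem IsInterpolatingFB.summable_residual
    (h : IsInterpolatingFB M A C γ βb (tunableLam γ βb e) y p)
    (hM : IsStronglyPositive M) (hA : IsMonotoneOp A) (hC : IsCocoercive M βb C) (hγ : 0 < γ)
    (hβb : 0 ≤ βb) (he : 0 ≤ e) (he' : e < 1) (ha : 0 < (1 - γ * βb / 4) ^ e)
    (ha' : 2 * (1 - γ * βb / 4) ^ e < 4 - γ * βb) (hzer : (zer A C).Nonempty) :
    Summable fun n : ℕ => ‖p n - y n‖ ^ 2 := by
  obtain ⟨xs, hxs⟩ := hzer
  have hlam := le_tunableLam (γ := γ) (βb := βb) he ha.le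
  have hrel := h.isRelaxedIteration fun n => (ha.trans_le (hlam (n + 1))).ne'
  rw [tunableLam_zero] at hrel
  have key := hrel.summable_residual hM.isSymm_bilinM hM.inner_self_nonneg ha (by linarith)
    tunableLam_zero hlam (mul_pos ha (sub_pos.2 he'))
    (fun n => by
      have := tunableLam_succ_sub_le (γ := γ) (βb := βb) he he'.le ha.le n
      linarith)
    (h.cocoercive_succ hM hA hC hγ hβb) (h.cocoercive_zer hM hA hC hγ hβb hxs)
  obtain ⟨c, hc, hcM⟩ := hM.2
  refine (summable_mul_left_iff hc.ne').1 (key.of_nonneg_of_le (fun n => by positivity)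
    fun n => ?_)
  rw [norm_sub_rev]
  exact hcM _

omit [CompleteSpace H] in
theorem IsInterpolatingFB.step_eq_of_exponent_zero
    (h : IsInterpolatingFB M A C γ βb (tunableLam γ βb 0) y p) (n : ℕ) : y (n + 1) = p n := by
  rw [h.step_y n]
  simp [tunableLam_zero_right]

theorem IsInterpolatingFB.exists_weaklyConverges
    (h : IsInterpolatingFB M A C γ βb (tunableLam γ βb 0) y p)
    (hM : IsStronglyPositive M) (hA : IsMaximallyMonotone A) (hC : IsCocoercive M βb C)
    (hγ : 0 < γ) (hβb : 0 ≤ βb) (hlt : γ * βb < 2) (hzer : (zer A C).Nonempty) :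
    ∃ xs ∈ zer A C, WeaklyConverges (fun n : ℕ => p n) xs := by
  have hsum := h.summable_residual hM hA.1 hC hγ hβb le_rfl zero_lt_one (by simp)
    (by rw [Real.rpow_zero]; linarith) hzer
  have hres : Tendsto (fun n : ℕ => y n - p n) atTop (𝓝 0) := by
    have h1 := hsum.tendsto_atTop_zero.sqrt
    simp only [Real.sqrt_sq (norm_nonneg _), Real.sqrt_zero] at h1
    rw [tendsto_zero_iff_norm_tendsto_zero]
    exact h1.congr fun n => norm_sub_rev _ _
  have hrel := h.isRelaxedIteration fun n => by simp [tunableLam_zero_right]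
  have hfejer : ∀ xs ∈ zer A C, Antitone fun n : ℕ => bilinM M (y n - xs) (y n - xs) := by
    refine fun xs hxs => antitone_nat_of_succ_le fun n => ?_
    have h1 := hrel.lyapunov_succ_le hM.isSymm_bilinM (by simp [tunableLam_zero_right]) n
      (by simp [tunableLam_zero_right]) (by simp [tunableLam_zero_right])
      (h.cocoercive_succ hM hA.1 hC hγ hβb n) (h.cocoercive_zer hM hA.1 hC hγ hβb hxs n)
    simp only [lyapunov, anchor, tunableLam_zero_right, div_one, sub_self, zero_smul, add_zero,
      mul_zero, zero_mul, sub_zero, one_mul, mul_one] at h1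
    have h2 : 0 ≤ bilinM M (y n - p n) (y n - p n) := hM.inner_self_nonneg _
    -- the decrease of the Lyapunov function is a nonnegative multiple of `h2`
    have h3 := mul_nonneg (by linarith : 0 ≤ 2 * (1 - γ * βb / 4) - 1) h2
    linarith
  have hpy : ∀ n : ℕ, p n = y (n + 1 : ℕ) := fun n => by
    rw [Nat.cast_succ, h.step_eq_of_exponent_zero]
  obtain ⟨z, hz⟩ := hzer
  obtain ⟨R, hR⟩ := hM.norm_le_of_bilinM_le (D := bilinM M (y 0 - z) (y 0 - z))
  have hbdd : ∀ n : ℕ, ‖y n‖ ≤ R + ‖z‖ := fun n => by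
    have := hR _ (hfejer z hz (Nat.zero_le n))
    have h2 := norm_add_le (y n - z) z
    rw [sub_add_cancel] at h2
    linarith
  refine opial hM ⟨z, hz⟩ (fun x hx m n hmn => ?_) fun U hU x hx =>
    mem_zer_of_weak_limit hM hA hC hβb hγ ⟨z, hz⟩ h.step_p hbdd
      (fun n => by rw [hpy]; exact hbdd _) (hres.mono_left hU) hx
  simp only [hpy]
  exact hfejer x hx (Nat.succ_le_succ hmn)

omit [CompleteSpace H] in
theorem IsInterpolatingFB.step_y_of_exponent_one
    (h : IsInterpolatingFB M A C γ βb (tunableLam γ βb 1) y p) (hlt : γ * βb < 4) (n : ℕ) :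
    y (n + 1) =
      (γ * βb * (1 + n) / (4 + 2 * n)) • y n
      + (n * (2 - γ * βb) / (4 + 2 * n)) • y (n - 1)
      + ((1 + n) * (4 - γ * βb) / (4 + 2 * n)) • p n
      - (n * (4 - γ * βb) / (4 + 2 * n)) • p (n - 1) := by
  have hκ : 4 - γ * βb ≠ 0 := by linarith
  have hn : (1 : ℝ) + (n + 1) ≠ 0 := by positivity
  have hn' : (4 : ℝ) + 2 * n ≠ 0 := by positivity
  have e1 : tunableLam γ βb 1 0 * tunableLam γ βb 1 n / tunableLam γ βb 1 (n + 1) =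
      (1 - γ * βb / 4) * (1 + n) / (1 + (n + 1)) := by
    simp only [tunableLam_one_right]; push_cast; field_simp; ring
  have e2 : (tunableLam γ βb 1 (n + 1) - tunableLam γ βb 1 0) / tunableLam γ βb 1 (n + 1) =
      (n + 1) / (1 + (n + 1)) := by
    simp only [tunableLam_one_right]; push_cast; field_simp; ring
  have e3 : (tunableLam γ βb 1 n - tunableLam γ βb 1 0) / tunableLam γ βb 1 (n + 1) =
      n / (1 + (n + 1)) := by
    simp only [tunableLam_one_right]; push_cast; field_simp; ring
  have e4 : tunableLam γ βb 1 0 = 1 - γ * βb / 4 := by simp [tunableLam_one_right]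
  rw [h.step_y n, e1, e2, e3, e4]
  match_scalars <;> field_simp <;> ring

omit [CompleteSpace H] in
theorem isInterpolatingFB_zero_iff_isAcceleratedPPM :
    IsInterpolatingFB M A (fun _ => 0) γ 0 (tunableLam γ 0 1) y p ↔
      IsAcceleratedPPM M A γ y p := by
  have hstep : ∀ n : ℕ,
      (p n + ((n : ℝ) / (n + 2)) • (p n - p (n - 1))
          - ((n : ℝ) / (n + 2)) • (p (n - 1) - y (n - 1)) =
        y n
        + (tunableLam γ 0 1 0 * tunableLam γ 0 1 n / tunableLam γ 0 1 (n + 1)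
            + (tunableLam γ 0 1 (n + 1) - tunableLam γ 0 1 0) / tunableLam γ 0 1 (n + 1)
              * ((4 - γ * 0 - 2 * tunableLam γ 0 1 0) / 2)) • (p n - y n)
        + ((tunableLam γ 0 1 n - tunableLam γ 0 1 0) / tunableLam γ 0 1 (n + 1)) •
            ((y n - y (n - 1)) + ((4 - γ * 0) / 2) • (y (n - 1) - p (n - 1)))) := by
    intro n
    have hn : (1 : ℝ) + (n + 1) ≠ 0 := by positivity
    have hn' : (n : ℝ) + 2 ≠ 0 := by positivity
    simp only [tunableLam_one_right]
    push_cast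
    match_scalars <;> field_simp <;> ring
  constructor
  · intro h
    exact ⟨h.init_y, h.init_p, fun n => by simpa [fbStep] using h.step_p n,
      fun n => (h.step_y n).trans (hstep n).symm⟩
  · intro h
    exact ⟨h.init_y, h.init_p, fun n => by simpa [fbStep] using h.step_p n,
      fun n => (h.step_y n).trans (hstep n)⟩

end Algorithm

/-! ### Halpern's iteration of a nonexpansive operator -/

section Halpern

variable [CompleteSpace H] {M : H →L[ℝ] H}

theorem IsNonexpansiveM.cocoercive (hM : IsStronglyPositive M) {N : H → H}
    (hN : IsNonexpansiveM M N) (x z : H) :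
    1 / 2 * bilinM M ((x - N x) - (z - N z)) ((x - N x) - (z - N z)) ≤
      bilinM M ((x - N x) - (z - N z)) (x - z) := by
  have h := pow_le_pow_left₀ (Real.sqrt_nonneg _) (hN x z) 2
  change normM M _ ^ 2 ≤ _ at h
  rw [hM.normM_sq, hM.normM_sq,
    show N x - N z = (x - z) - ((x - N x) - (z - N z)) by abel] at h
  generalize (x - N x) - (z - N z) = r at *
  generalize x - z = d at *
  have hs : bilinM M d r = bilinM M r d := hM.isSymm_bilinM.eq _ _
  simp only [map_sub, LinearMap.sub_apply, hs] at h
  linarith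

omit [CompleteSpace H] in
/-- The momentum is `(y 0 - y n) / n`; for `n = 0` the division by zero yields the required value
`0`. -/
theorem IsHalpern.isRelaxedIteration {N : H → H} {y : ℕ → H} (h : IsHalpern N y) :
    IsRelaxedIteration (1 / 2) (1 / 2) (fun n => ((n : ℝ) + 1) / 2) y (fun n => y n - N (y n))
      (fun n => (1 / (n : ℝ)) • (y 0 - y n)) where
  init_w := by simp
  step_y n := by
    have hn : (n : ℝ) + 2 ≠ 0 := by positivity
    have hn' : (n : ℝ) + 1 ≠ 0 := by positivity
    rw [h n]
    push_cast
    match_scalars <;> field_simp <;> ring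
  step_w n := by
    have hn : (n : ℝ) + 2 ≠ 0 := by positivity
    have hn' : (n : ℝ) + 1 ≠ 0 := by positivity
    rw [h n]
    push_cast
    rcases n.eq_zero_or_pos with rfl | hpos
    · match_scalars <;> norm_num
    · have : (n : ℝ) ≠ 0 := by positivity
      match_scalars <;> field_simp <;> ring

theorem IsHalpern.normM_residual_sq_le (hM : IsStronglyPositive M) {N : H → H} {y : ℕ → H}
    (hN : IsNonexpansiveM M N) (h : IsHalpern N y) {xs : H} (hxs : N xs = xs) (n : ℕ) :
    normM M (N (y n) - y n) ^ 2 ≤ 4 * normM M (y 0 - xs) ^ 2 / (1 + (n : ℝ)) ^ 2 := by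
  have key := h.isRelaxedIteration.residual_le hM.isSymm_bilinM hM.inner_self_nonneg
    (by norm_num) (by norm_num) (by norm_num)
    (fun n => by have : (0 : ℝ) ≤ n := n.cast_nonneg; linarith)
    (fun n => by push_cast; linarith)
    (fun n => hN.cocoercive hM (y (n + 1)) (y n))
    (fun n => by simpa [hxs] using hN.cocoercive hM (y n) xs) n
  have h1 := hM.normM_smul_sub_sq 1 (N (y n)) (y n)
  rw [div_one, one_smul, one_pow, div_one] at h1
  rw [h1, hM.normM_sq, le_div_iff₀ (by positivity)]
  linarith

end Halpern

/-! ### Halpern's iteration as a forward-backward method -/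

section HalpernSpecialCase

variable [CompleteSpace H] {M : H →L[ℝ] H} {C : H → H} {γ β : ℝ} {y p : ℤ → H}

theorem IsCocoercive.isNonexpansiveM (hC : IsCocoercive M β C) (hM : IsStronglyPositive M)
    (hβ : 0 < β) : IsNonexpansiveM M fun x => x - (2 / β) • M.inverse (C x) := fun x z => by
  have h := hC.bilinM_le hM x z
  refine Real.sqrt_le_sqrt ?_
  change bilinM M _ _ ≤ bilinM M _ _
  rw [show x - (2 / β) • M.inverse (C x) - (z - (2 / β) • M.inverse (C z)) =
    (x - z) - (2 / β) • (M.inverse (C x) - M.inverse (C z)) by module]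
  generalize M.inverse (C x) - M.inverse (C z) = u at *
  generalize x - z = d at *
  have hs : bilinM M d u = bilinM M u d := hM.isSymm_bilinM.eq _ _
  simp only [map_sub, map_smul, LinearMap.sub_apply, LinearMap.smul_apply, smul_eq_mul, hs]
  have h1 := mul_le_mul_of_nonneg_left h (by positivity : 0 ≤ 4 / β ^ 2)
  refine sub_nonneg.1 ((sub_nonneg.2 h1).trans_eq ?_)
  field_simp
  ring

theorem eq_of_mem_fbStep_zero (hM : IsStronglyPositive M) {x z : H}
    (h : z ∈ fbStep M (fun _ => {0}) C γ x) : z = x - γ • M.inverse (C x) := by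
  obtain ⟨a, rfl, h⟩ := h
  refine hM.isInvertible.injective ?_
  rw [smul_zero, add_zero] at h
  rw [h, map_sub, map_smul, hM.apply_inverse]

omit [CompleteSpace H] in
/-- For `e = 1` the auxiliary point `anchor` stays at `y 0`, which for `γ β = 2` is Halpern's
step. -/
theorem IsInterpolatingFB.step_y_halpern {A : H → Set H}
    (h : IsInterpolatingFB M A C γ β (tunableLam γ β 1) y p) (hγβ : γ * β = 2) (n : ℕ) :
    y (n + 1) = (1 / ((n : ℝ) + 2)) • y 0 + (((n : ℝ) + 1) / (n + 2)) • p n := by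
  have hlam : ∀ n : ℕ, tunableLam γ β 1 n = (1 + n) / 2 := fun n => by
    rw [tunableLam_one_right, hγβ]; ring
  have hrel := h.isRelaxedIteration fun n => by rw [hlam]; positivity
  have hanchor : ∀ n : ℕ, anchor (tunableLam γ β 1 0) (tunableLam γ β 1) (fun n : ℕ => y n)
      (fun n : ℕ => y n - y (n - 1) + (2 * (1 - γ * β / 4)) • (y (n - 1) - p (n - 1))) n =
        y 0 := by
    intro n
    induction n with
    | zero => simp [anchor, h.init_y, h.init_p]
    | succ n ih =>
      rw [hrel.anchor_succ (by rw [hlam]; norm_num), ih]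
      simp only [hlam]
      push_cast
      module
  have h1 := hanchor (n + 1)
  simp only [anchor, hlam, hγβ] at h1
  push_cast at h1
  rw [add_sub_cancel_right] at h1
  have hn : (n : ℝ) + 2 ≠ 0 := by positivity
  rw [← h1]
  match_scalars <;> field_simp <;> ring

end HalpernSpecialCase

end TunableFB

/-! ### Convergence of the tunable forward-backward method -/

theorem mainTheorem4 {H : Type*} [NormedAddCommGroup H] [InnerProductSpace ℝ H] [CompleteSpace H]
    (M : H →L[ℝ] H) (hM : TunableFB.IsStronglyPositive M) :
    -- the tunable forward-backward algorithm
    (∀ (A : H → Set H) (C : H → H) (β βb γ ε e : ℝ) (y p : ℤ → H),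
      0 ≤ β → TunableFB.IsMaximallyMonotone A → TunableFB.IsCocoercive M β C →
      (TunableFB.zer A C).Nonempty →
      0 < γ → 0 < ε → 0 ≤ e → e ≤ 1 → β ≤ βb →
      0 < (1 - γ * βb / 4) ^ e →
      ε ≤ γ * βb → γ * βb ≤ 4 - 2 * (1 - γ * βb / 4) ^ e - ε →
      TunableFB.IsInterpolatingFB M A C γ βb (TunableFB.tunableLam γ βb e) y p →
      -- convergence rate of the fixed-point residual
      (0 < e → ∀ xs ∈ TunableFB.zer A C, ∀ n : ℕ,
        TunableFB.normM M ((1 / γ) • (p n - y n)) ^ 2 ≤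
          2 * TunableFB.normM M (y 0 - xs) ^ 2 /
            (γ ^ 2 * (4 - γ * βb - 2 * (1 - γ * βb / 4) ^ e) * (1 - γ * βb / 4) ^ e
              * (1 + (n : ℝ)) ^ (2 * e))) ∧
      -- summability
      (β < βb → e < 1 → Summable (fun n : ℕ => ‖p n - y n‖ ^ 2)) ∧
      -- forward-backward splitting
      (e = 0 →
        (∀ n : ℕ, y (n + 1) = p n ∧ y (n + 1) ∈ TunableFB.fbStep M A C γ (y n)) ∧
        ∃ xs ∈ TunableFB.zer A C, TunableFB.WeaklyConverges (fun n : ℕ => p n) xs) ∧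
      -- accelerated forward-backward method
      (e = 1 →
        (∀ n : ℕ, y (n + 1) =
          (γ * βb * (1 + n) / (4 + 2 * n)) • y n
          + (n * (2 - γ * βb) / (4 + 2 * n)) • y (n - 1)
          + ((1 + n) * (4 - γ * βb) / (4 + 2 * n)) • p n
          - (n * (4 - γ * βb) / (4 + 2 * n)) • p (n - 1)) ∧
        (∀ xs ∈ TunableFB.zer A C, ∀ n : ℕ,
          TunableFB.normM M ((1 / γ) • (p n - y n)) ^ 2 ≤
            16 * TunableFB.normM M (y 0 - xs) ^ 2 /
              (γ ^ 2 * (4 - γ * βb) ^ 2 * (1 + (n : ℝ)) ^ 2))) ∧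
      -- for `A = 0`, `βb = β`, `γ β = 2` this is the Halpern iteration of `Id - (2/β) M⁻¹ C`
      (e = 1 → A = (fun _ => {0}) → βb = β → γ * β = 2 →
        TunableFB.IsNonexpansiveM M (fun x => x - (2 / β) • M.inverse (C x)) ∧
        (∀ n : ℕ, p n = y n - (2 / β) • M.inverse (C (y n))) ∧
        TunableFB.IsHalpern (fun x => x - (2 / β) • M.inverse (C x)) (fun n : ℕ => y n) ∧
        (∀ xs ∈ TunableFB.zer A C, ∀ n : ℕ,
          TunableFB.normM M (p n - y n) ^ 2 ≤
            4 * TunableFB.normM M (y 0 - xs) ^ 2 / (1 + (n : ℝ)) ^ 2))) ∧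
    -- accelerated proximal point method (`C = 0`, `βb = β = 0`, `e = 1`)
    (∀ (A : H → Set H) (γ : ℝ) (y p : ℤ → H),
      TunableFB.IsMaximallyMonotone A → 0 < γ →
      (TunableFB.IsInterpolatingFB M A (fun _ => 0) γ 0 (TunableFB.tunableLam γ 0 1) y p ↔
        TunableFB.IsAcceleratedPPM M A γ y p) ∧
      (TunableFB.IsAcceleratedPPM M A γ y p →
        ∀ xs : H, 0 ∈ A xs → ∀ n : ℕ,
          TunableFB.normM M ((1 / γ) • (p n - y n)) ^ 2 ≤
            TunableFB.normM M (y 0 - xs) ^ 2 / (γ ^ 2 * (1 + (n : ℝ)) ^ 2))) ∧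
    -- Halpern iteration of an arbitrary nonexpansive operator with a fixed point
    (∀ (N : H → H) (y : ℕ → H),
      TunableFB.IsNonexpansiveM M N → TunableFB.IsHalpern N y →
      ∀ xs : H, N xs = xs → ∀ n : ℕ,
        TunableFB.normM M (N (y n) - y n) ^ 2 ≤
          4 * TunableFB.normM M (y 0 - xs) ^ 2 / (1 + (n : ℝ)) ^ 2) := by
  
  refine ⟨?_, ?_, ?_⟩
  · intro A C β βb γ ε e y p hβ hA hC hzer hγ hε he he' hβb ha _ ha' h
    have hCb := hC.mono hM hβ hβb
    have hβb0 := hβ.trans hβb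
    have ha2 : 2 * (1 - γ * βb / 4) ^ e < 4 - γ * βb := by linarith
    have hrate : ∀ xs ∈ TunableFB.zer A C, ∀ n : ℕ, _ := fun xs hxs n =>
      h.normM_residual_sq_le hM hA.1 hCb hγ hβb0 he he' ha ha2 hxs n
    have hrate_one : e = 1 → ∀ xs ∈ TunableFB.zer A C, ∀ n : ℕ,
        TunableFB.normM M ((1 / γ) • (p n - y n)) ^ 2 ≤
          16 * TunableFB.normM M (y 0 - xs) ^ 2 /
            (γ ^ 2 * (4 - γ * βb) ^ 2 * (1 + (n : ℝ)) ^ 2) := by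
      rintro rfl xs hxs n
      rw [Real.rpow_one] at ha2 ha
      have h4 : 4 - γ * βb ≠ 0 := by linarith
      refine (hrate xs hxs n).trans_eq ?_
      rw [mul_one, Real.rpow_one, Real.rpow_two,
        show 4 - γ * βb - 2 * (1 - γ * βb / 4) = (4 - γ * βb) / 2 by ring,
        show 1 - γ * βb / 4 = (4 - γ * βb) / 4 by ring]
      field_simp
      ring
    refine ⟨fun _ => hrate, fun _ he1 =>
      h.summable_residual hM hA.1 hCb hγ hβb0 he he1 ha ha2 hzer, ?_, ?_, ?_⟩
    · rintro rfl
      refine ⟨fun n => ?_, h.exists_weaklyConverges hM hA hCb hγ hβb0 ?_ hzer⟩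
      · rw [h.step_eq_of_exponent_zero n]
        exact ⟨rfl, h.step_p n⟩
      · rw [Real.rpow_zero] at ha2
        linarith only [ha2]
    · intro he1
      refine ⟨fun n => ?_, hrate_one he1⟩
      subst he1
      rw [Real.rpow_one] at ha
      exact h.step_y_of_exponent_one (by linarith) n
    · rintro he1 rfl rfl hγβ
      have hβ0 : 0 < βb := pos_of_mul_pos_right (hγβ ▸ two_pos) hγ.le
      have hγ2 : 2 / βb = γ := by rw [← hγβ]; field_simp
      have hp : ∀ n : ℕ, p n = y n - (2 / βb) • M.inverse (C (y n)) := fun n => by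
        rw [hγ2]
        exact TunableFB.eq_of_mem_fbStep_zero hM (h.step_p n)
      refine ⟨hC.isNonexpansiveM hM hβ0, hp, fun n => ?_, fun xs hxs n => ?_⟩
      · subst he1
        have h1 := h.step_y_halpern hγβ n
        rw [hp n] at h1
        exact_mod_cast h1
      · have h1 := hrate_one he1 xs hxs n
        rw [hM.normM_smul_sub_sq, hγβ] at h1
        have h2 := hM.normM_smul_sub_sq 1 (p n) (y n)
        rw [div_one, one_smul, one_pow, div_one] at h2
        rw [h2]
        rw [div_le_iff₀ (by positivity)] at h1
        refine h1.trans_eq ?_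
        field_simp
        ring
  · intro A γ y p hA hγ
    refine ⟨TunableFB.isInterpolatingFB_zero_iff_isAcceleratedPPM, fun h xs hxs n => ?_⟩
    have h' := TunableFB.isInterpolatingFB_zero_iff_isAcceleratedPPM.2 h
    have hC : TunableFB.IsCocoercive M 0 (fun _ : H => 0) := fun x z => by
      simp [TunableFB.normM]
    have key := h'.normM_residual_sq_le hM hA.1 hC hγ le_rfl zero_le_one le_rfl
      (by norm_num) (by norm_num) (xs := xs) ⟨0, hxs, add_zero 0⟩ n
    refine key.trans_eq ?_
    rw [mul_one, Real.rpow_two, Real.rpow_one]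
    field_simp
    ring
  · intro N y hN h xs hxs n
    exact h.normM_residual_sq_le hM hN hxs n
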